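/- **Theorem 2.1.** All spaces are complex and Banach algebras need not be unital. A Banach $\mathcal A$-module is a Banach space $E$ which is an $\mathcal A$-bimodule with bilinear actions satisfying $\|a\cdot x\|\le\|a\|\|x\|$ and $\|x\cdot a\|\le\|a\|\|x\|$; its dual $E^*$ is the Banach $\mathcal A$-module with $\langle a\cdot\varphi,x\rangle=\langle\varphi,x\cdot a\rangle$, $\langle\varphi\cdot a,x\rangle=\langle\varphi,a\cdot x\rangle$. For a Banach algebra $\mathcal A$ and $\Phi,\Psi\in\mathcal A^{**}$, the first Arens product is given by $\langle\Phi\,\square\,\Psi,f\rangle=\langle\Phi,\Psi\cdot f\rangle$, $\langle\Psi\cdot f,a\rangle=\langle\Psi,f\cdot a\rangle$, and the second by $\langle\Phi\,\Diamond\,\Psi,f\rangle=\langle\Psi,f\cdot\Phi\rangle$, $\langle f\cdot\Phi,a\rangle=\langle\Phi,a\cdot f\rangle$, for $f\in\mathcal A^*$, $a\in\mathcal A$, where $\langle f\cdot a,b\rangle=\langle f,ab\rangle$ and $\langle a\cdot f,b\rangle=\langle f,ba\rangle$. $\mathcal A$ is *Arens regular* if the two products coincide on $\mathcal A^{**}$.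 We regard $\mathcal A^{**}$ as a Banach algebra under the first Arens product. A *dual Banach algebra* is a Banach algebra $\mathfrak A$ with a closed submodule $\mathfrak A_*\subseteq\mathfrak A^*$ (its predual) such that evaluation is an isometric isomorphism $\mathfrak A=(\mathfrak A_*)^*$; its weak$^*$ topology is $\sigma(\mathfrak A,\mathfrak A_*)$. A dual Banach $\mathfrak A$-module $X=E^*$ ($E$ a Banach $\mathfrak A$-module) is *normal* if for every $x\in X$ the maps $a\mapsto a\cdot x$ and $a\mapsto x\cdot a$ from $\mathfrak A$ to $X$ are weak$^*$-weak$^*$ continuous. $\mathfrak A$ is *Connes amenable* if for every normal dual Banach $\mathfrak A$-module $X$, every weak$^*$-weak$^*$ continuous linear map $D:\mathfrak A\to X$ with $D(ab)=D(a)\cdot b+a\cdot D(b)$ for all $a,b$ is of the form $D(a)=a\cdot x-x\cdot a$ for some $x\in X$. If $\mathcal A$ is Arens regular, $\mathcal A^{**}$ is a dual Banach algebra with predual $\mathcal A^*$ (canonically embedded in $\mathcal A^{***}$). Let $\mathcal A$ be an Arens regular Banach algebra and let $M$ be a reflexive Banach $\mathcal A$-module. Let $\mathcal B=M\oplus_1\mathcal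 A$ be the module extension Banach algebra, with norm $\|(m,a)\|=\|m\|+\|a\|$ and product $$(m_1,a_1)(m_2,a_2)=(m_1\cdot a_2+a_1\cdot m_2,\;a_1a_2).$$ Then (i) $\mathcal B$ is Arens regular. (ii) $\mathcal B^{**}$ (with predual $\mathcal B^*$) is Connes amenable if and only if $M=0$ and $\mathcal A^{**}$ (with predual $\mathcal A^*$) is Connes amenable. -/

import Mathlib

open scoped Topology

set_option maxSynthPendingDepth 3
set_option linter.unusedSectionVars false

universe u

noncomputable section

/-! Complex Banach algebras are not assumed to be unital: they are complete
`NonUnitalNormedRing`s carrying a compatible structure of complex normed space. -/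

section Bimodule

/-- A Banach `A`-bimodule structure on `E`: bilinear left and right actions
`left a x = a · x` and `right a x = x · a` with `‖a · x‖ ≤ ‖a‖ ‖x‖` and `‖x · a‖ ≤ ‖a‖ ‖x‖`. -/
class BanachBimodule (A : Type*) (E : Type*) [NonUnitalNormedRing A] [NormedSpace ℂ A]
    [NormedAddCommGroup E] [NormedSpace ℂ E] where
  left : A →L[ℂ] E →L[ℂ] E
  right : A →L[ℂ] E →L[ℂ] E
  left_mul : ∀ (a b : A) (x : E), left (a * b) x = left a (left b x)
  right_mul : ∀ (a b : A) (x : E), right (a * b) x = right b (right a x)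
  left_right : ∀ (a b : A) (x : E), right b (left a x) = left a (right b x)
  norm_left_le : ∀ (a : A) (x : E), ‖left a x‖ ≤ ‖a‖ * ‖x‖
  norm_right_le : ∀ (a : A) (x : E), ‖right a x‖ ≤ ‖a‖ * ‖x‖

/-- The left action `a · x`. -/
def lact {A E : Type*} [NonUnitalNormedRing A] [NormedSpace ℂ A]
    [NormedAddCommGroup E] [NormedSpace ℂ E] [BanachBimodule A E] (a : A) (x : E) : E :=
  BanachBimodule.left a x

/-- The right action `x · a`. -/
def ract {A E : Type*} [NonUnitalNormedRing A] [NormedSpace ℂ A]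
    [NormedAddCommGroup E] [NormedSpace ℂ E] [BanachBimodule A E] (x : E) (a : A) : E :=
  BanachBimodule.right a x

/-- The adjoint `B^t : G* × E → F*`, `⟨B^t(g, x), y⟩ = ⟨g, B(x, y)⟩`, of a bounded bilinear map
`B : E × F → G`. -/
def bilinAdjoint {E F G : Type*} [NormedAddCommGroup E] [NormedSpace ℂ E]
    [NormedAddCommGroup F] [NormedSpace ℂ F] [NormedAddCommGroup G] [NormedSpace ℂ G]
    (B : E →L[ℂ] F →L[ℂ] G) : StrongDual ℂ G →L[ℂ] E →L[ℂ] StrongDual ℂ F :=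
  ((ContinuousLinearMap.compL ℂ E (F →L[ℂ] G) (StrongDual ℂ F)).flip B).comp
    (ContinuousLinearMap.compL ℂ F G ℂ)

@[simp] theorem bilinAdjoint_apply {E F G : Type*} [NormedAddCommGroup E] [NormedSpace ℂ E]
    [NormedAddCommGroup F] [NormedSpace ℂ F] [NormedAddCommGroup G] [NormedSpace ℂ G]
    (B : E →L[ℂ] F →L[ℂ] G) (g : StrongDual ℂ G) (x : E) (y : F) :
    bilinAdjoint B g x y = g (B x y) := rfl

theorem norm_bilinAdjoint_apply_le {E F G : Type*} [NormedAddCommGroup E] [NormedSpace ℂ E]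
    [NormedAddCommGroup F] [NormedSpace ℂ F] [NormedAddCommGroup G] [NormedSpace ℂ G]
    (B : E →L[ℂ] F →L[ℂ] G) (hB : ∀ x y, ‖B x y‖ ≤ ‖x‖ * ‖y‖) (g : StrongDual ℂ G) (x : E) :
    ‖bilinAdjoint B g x‖ ≤ ‖g‖ * ‖x‖ := by
  refine ContinuousLinearMap.opNorm_le_bound _ (by positivity) fun y => ?_
  rw [bilinAdjoint_apply, mul_assoc]
  exact (g.le_opNorm _).trans (mul_le_mul_of_nonneg_left (hB x y) (norm_nonneg g))

/-- The dual bimodule `E*`: `⟨a · φ, x⟩ = ⟨φ, x · a⟩` and `⟨φ · a, x⟩ = ⟨φ, a · x⟩`. -/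
instance dualBimodule {A E : Type*} [NonUnitalNormedRing A] [NormedSpace ℂ A]
    [NormedAddCommGroup E] [NormedSpace ℂ E] [BanachBimodule A E] :
    BanachBimodule A (StrongDual ℂ E) where
  left := (bilinAdjoint (BanachBimodule.right (A := A) (E := E))).flip
  right := (bilinAdjoint (BanachBimodule.left (A := A) (E := E))).flip
  left_mul a b φ := by
    ext x; simp [BanachBimodule.right_mul]
  right_mul a b φ := by
    ext x; simp [BanachBimodule.left_mul]
  left_right a b φ := by
    ext x; simp [BanachBimodule.left_right]
  norm_left_le a φ := by
    rw [mul_comm]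
    exact norm_bilinAdjoint_apply_le _ BanachBimodule.norm_right_le φ a
  norm_right_le a φ := by
    rw [mul_comm]
    exact norm_bilinAdjoint_apply_le _ BanachBimodule.norm_left_le φ a

theorem lact_dual_apply {A E : Type*} [NonUnitalNormedRing A] [NormedSpace ℂ A]
    [NormedAddCommGroup E] [NormedSpace ℂ E] [BanachBimodule A E]
    (a : A) (φ : StrongDual ℂ E) (x : E) : lact a φ x = φ (ract x a) := rfl

theorem ract_dual_apply {A E : Type*} [NonUnitalNormedRing A] [NormedSpace ℂ A]
    [NormedAddCommGroup E] [NormedSpace ℂ E] [BanachBimodule A E]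
    (a : A) (φ : StrongDual ℂ E) (x : E) : ract φ a x = φ (lact a x) := rfl

end Bimodule

section Arens

variable (A : Type u) [NonUnitalNormedRing A] [NormedSpace ℂ A] [IsScalarTower ℂ A A]
  [SMulCommClass ℂ A A]

/-- The first Arens product on `A**`, determined by
`⟨Φ □ Ψ, f⟩ = ⟨Φ, Ψ · f⟩`, `⟨Ψ · f, a⟩ = ⟨Ψ, f · a⟩`, `⟨f · a, b⟩ = ⟨f, a b⟩`. -/
def firstArens : StrongDual ℂ (StrongDual ℂ A) →L[ℂ] StrongDual ℂ (StrongDual ℂ A) →L[ℂ]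
    StrongDual ℂ (StrongDual ℂ A) :=
  bilinAdjoint (bilinAdjoint (bilinAdjoint (ContinuousLinearMap.mul ℂ A)))

/-- The second Arens product on `A**`, determined by
`⟨Φ ◇ Ψ, f⟩ = ⟨Ψ, f · Φ⟩`, `⟨f · Φ, a⟩ = ⟨Φ, a · f⟩`, `⟨a · f, b⟩ = ⟨f, b a⟩`. -/
def secondArens : StrongDual ℂ (StrongDual ℂ A) →L[ℂ] StrongDual ℂ (StrongDual ℂ A) →L[ℂ]
    StrongDual ℂ (StrongDual ℂ A) :=
  (bilinAdjoint (bilinAdjoint (bilinAdjoint (ContinuousLinearMap.mul ℂ A).flip))).flip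

/-- `A` is Arens regular: the two Arens products on `A**` coincide. -/
def IsArensRegular : Prop :=
  ∀ Φ Ψ : StrongDual ℂ (StrongDual ℂ A), firstArens A Φ Ψ = secondArens A Φ Ψ

theorem firstArens_assoc (Φ Ψ Θ : StrongDual ℂ (StrongDual ℂ A)) :
    firstArens A (firstArens A Φ Ψ) Θ = firstArens A Φ (firstArens A Ψ Θ) := by
  refine ContinuousLinearMap.ext fun f => ?_
  change Φ _ = Φ _
  congr 1
  refine ContinuousLinearMap.ext fun a => ?_
  change Ψ _ = Ψ _
  congr 1
  refine ContinuousLinearMap.ext fun b => ?_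
  change Θ _ = Θ _
  congr 1
  refine ContinuousLinearMap.ext fun c => ?_
  change f _ = f _
  exact congrArg f (mul_assoc a b c)

end Arens

/-- The second dual `A**` of a Banach algebra, as a Banach algebra under the first Arens
product. -/
def Bidual (A : Type u) [NonUnitalNormedRing A] [NormedSpace ℂ A] : Type u :=
  StrongDual ℂ (StrongDual ℂ A)

namespace Bidual

variable {A : Type u} [NonUnitalNormedRing A] [NormedSpace ℂ A]

instance : NormedAddCommGroup (Bidual A) :=
  inferInstanceAs (NormedAddCommGroup (StrongDual ℂ (StrongDual ℂ A)))

instance : NormedSpace ℂ (Bidual A) :=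
  inferInstanceAs (NormedSpace ℂ (StrongDual ℂ (StrongDual ℂ A)))

instance : CompleteSpace (Bidual A) :=
  inferInstanceAs (CompleteSpace (StrongDual ℂ (StrongDual ℂ A)))

variable [IsScalarTower ℂ A A] [SMulCommClass ℂ A A]

instance : Mul (Bidual A) := ⟨fun Φ Ψ => firstArens A Φ Ψ⟩

theorem mul_def (Φ Ψ : Bidual A) : Φ * Ψ = firstArens A Φ Ψ := rfl

instance : NonUnitalNormedRing (Bidual A) where
  __ := (inferInstance : NormedAddCommGroup (Bidual A))
  mul := (· * ·)
  left_distrib Φ Ψ Θ := map_add (firstArens A Φ) Ψ Θ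
  right_distrib Φ Ψ Θ := by
    change firstArens A (Φ + Ψ) Θ = firstArens A Φ Θ + firstArens A Ψ Θ
    exact (firstArens A).map_add₂ Φ Ψ Θ
  zero_mul Φ := by
    change firstArens A 0 Φ = 0
    exact (firstArens A).map_zero₂ Φ
  mul_zero Φ := map_zero (firstArens A Φ)
  mul_assoc Φ Ψ Θ := firstArens_assoc A Φ Ψ Θ
  norm_mul_le Φ Ψ := by
    refine norm_bilinAdjoint_apply_le _ (fun Θ f => ?_) Φ Ψ
    refine norm_bilinAdjoint_apply_le _ (fun g a => ?_) Θ f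
    exact norm_bilinAdjoint_apply_le _ (fun a b => norm_mul_le a b) g a

instance : IsScalarTower ℂ (Bidual A) (Bidual A) :=
  ⟨fun c Φ Ψ => (firstArens A).map_smul₂ c Φ Ψ⟩

instance : SMulCommClass ℂ (Bidual A) (Bidual A) :=
  ⟨fun c Φ Ψ => (map_smul (firstArens A Φ) c Ψ).symm⟩

end Bidual

section ConnesAmenability

variable {𝔄 : Type u} [NonUnitalNormedRing 𝔄] [NormedSpace ℂ 𝔄]

/-- The canonical map `𝔄 → P*` for a subspace `P` of `𝔄*`, given by evaluation. -/
def predualEval (P : Submodule ℂ (StrongDual ℂ 𝔄)) (a : 𝔄) : StrongDual ℂ P :=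
  (NormedSpace.inclusionInDoubleDual ℂ 𝔄 a).comp P.subtypeL

/-- `𝔄` is a dual Banach algebra with predual `P`: `P` is a closed sub-bimodule of `𝔄*`
such that `𝔄 = P*` (isometrically) via evaluation. -/
structure IsPredual [IsScalarTower ℂ 𝔄 𝔄] [SMulCommClass ℂ 𝔄 𝔄]
    (P : Submodule ℂ (StrongDual ℂ 𝔄)) : Prop where
  isClosed : IsClosed (P : Set (StrongDual ℂ 𝔄))
  mul_left_mem : ∀ f ∈ P, ∀ a : 𝔄, f.comp (ContinuousLinearMap.mul ℂ 𝔄 a) ∈ P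
  mul_right_mem : ∀ f ∈ P, ∀ a : 𝔄, f.comp ((ContinuousLinearMap.mul ℂ 𝔄).flip a) ∈ P
  bijective : Function.Bijective (predualEval P)
  norm_eval : ∀ a : 𝔄, ‖predualEval P a‖ = ‖a‖

/-- The weak* topology `σ(𝔄, P)`: the coarsest topology making every `f ∈ P` continuous. -/
@[reducible] def weakStarTopology (P : Submodule ℂ (StrongDual ℂ 𝔄)) : TopologicalSpace 𝔄 :=
  TopologicalSpace.induced (fun (a : 𝔄) (f : P) => (f : StrongDual ℂ 𝔄) a) inferInstance

/-- `T : 𝔄 → E*` is continuous for `σ(𝔄, P)` on `𝔄` and `σ(E*, E)` on `E*`. -/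
def IsWeakStarContinuous (P : Submodule ℂ (StrongDual ℂ 𝔄)) {E : Type u} [NormedAddCommGroup E]
    [NormedSpace ℂ E] (T : 𝔄 → StrongDual ℂ E) : Prop :=
  Continuous[weakStarTopology P, inferInstance] fun a : 𝔄 => StrongDual.toWeakDual (T a)

/-- The dual bimodule `E*` is normal: for each `φ ∈ E*` the maps `a ↦ a · φ` and `a ↦ φ · a`
are weak*-weak* continuous. -/
def IsNormalDual (P : Submodule ℂ (StrongDual ℂ 𝔄)) (E : Type u) [NormedAddCommGroup E]
    [NormedSpace ℂ E] [BanachBimodule 𝔄 E] : Prop :=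
  ∀ φ : StrongDual ℂ E, IsWeakStarContinuous P (fun a : 𝔄 => lact a φ) ∧
    IsWeakStarContinuous P (fun a : 𝔄 => ract φ a)

/-- `D(ab) = D(a) · b + a · D(b)`. -/
def IsDerivationMap {X : Type*} [NormedAddCommGroup X] [NormedSpace ℂ X] [BanachBimodule 𝔄 X]
    (D : 𝔄 →ₗ[ℂ] X) : Prop :=
  ∀ a b : 𝔄, D (a * b) = ract (D a) b + lact a (D b)

/-- `D(a) = a · x - x · a` for some `x`. -/
def IsInnerMap {X : Type*} [NormedAddCommGroup X] [NormedSpace ℂ X] [BanachBimodule 𝔄 X]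
    (D : 𝔄 →ₗ[ℂ] X) : Prop :=
  ∃ x : X, ∀ a : 𝔄, D a = lact a x - ract x a

/-- `𝔄` is a dual Banach algebra with predual `P`, and every weak*-weak* continuous derivation
from `𝔄` into a normal dual Banach `𝔄`-bimodule `E*` is inner. -/
def IsConnesAmenable [IsScalarTower ℂ 𝔄 𝔄] [SMulCommClass ℂ 𝔄 𝔄]
    (P : Submodule ℂ (StrongDual ℂ 𝔄)) : Prop :=
  IsPredual P ∧
  ∀ (E : Type u) [NormedAddCommGroup E] [NormedSpace ℂ E] [CompleteSpace E]
    [BanachBimodule 𝔄 E], IsNormalDual P E →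
    ∀ D : 𝔄 →ₗ[ℂ] StrongDual ℂ E, IsDerivationMap D → IsWeakStarContinuous P D → IsInnerMap D

end ConnesAmenability

/-- `A*`, canonically embedded in `A*** = (A**)*`. -/
def Bidual.predual (A : Type u) [NonUnitalNormedRing A] [NormedSpace ℂ A]
    [IsScalarTower ℂ A A] [SMulCommClass ℂ A A] : Submodule ℂ (StrongDual ℂ (Bidual A)) :=
  LinearMap.range (NormedSpace.inclusionInDoubleDual ℂ (StrongDual ℂ A)).toLinearMap

/-- `M` is reflexive: the canonical map `M → M**` is onto. -/
def IsReflexiveSpace (M : Type*) [NormedAddCommGroup M] [NormedSpace ℂ M] : Prop :=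
  Function.Surjective (NormedSpace.inclusionInDoubleDual ℂ M)

/-- The module extension `M ⊕₁ A`, with norm `‖(m, a)‖ = ‖m‖ + ‖a‖`. -/
def ModuleExtension (M A : Type u) : Type u := WithLp 1 (M × A)

namespace ModuleExtension

variable {M A : Type u}

/-- The element `(m, a)`. -/
def mk (m : M) (a : A) : ModuleExtension M A := WithLp.toLp 1 (m, a)

/-- The component in `M`. -/
def fst (x : ModuleExtension M A) : M := (WithLp.ofLp x).1

/-- The component in `A`. -/
def snd (x : ModuleExtension M A) : A := (WithLp.ofLp x).2

theorem ext {x y : ModuleExtension M A} (h₁ : x.fst = y.fst) (h₂ : x.snd = y.snd) : x = y :=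
  WithLp.ofLp_injective 1 (Prod.ext h₁ h₂)

variable [NonUnitalNormedRing A] [NormedSpace ℂ A] [NormedAddCommGroup M] [NormedSpace ℂ M]

instance : NormedAddCommGroup (ModuleExtension M A) :=
  inferInstanceAs (NormedAddCommGroup (WithLp 1 (M × A)))

instance : NormedSpace ℂ (ModuleExtension M A) :=
  inferInstanceAs (NormedSpace ℂ (WithLp 1 (M × A)))

instance [CompleteSpace M] [CompleteSpace A] : CompleteSpace (ModuleExtension M A) :=
  inferInstanceAs (CompleteSpace (WithLp 1 (M × A)))

theorem norm_def (x : ModuleExtension M A) : ‖x‖ = ‖x.fst‖ + ‖x.snd‖ :=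
  WithLp.prod_norm_eq_of_nat 1 (by norm_num) x |>.trans (by simp [fst, snd, WithLp.fst, WithLp.snd])

variable [BanachBimodule A M]

/-- The product `(m₁, a₁)(m₂, a₂) = (m₁ · a₂ + a₁ · m₂, a₁ a₂)`. -/
instance : Mul (ModuleExtension M A) :=
  ⟨fun x y => mk (ract x.fst y.snd + lact x.snd y.fst) (x.snd * y.snd)⟩

theorem fst_mul (x y : ModuleExtension M A) :
    (x * y).fst = ract x.fst y.snd + lact x.snd y.fst := rfl

theorem snd_mul (x y : ModuleExtension M A) : (x * y).snd = x.snd * y.snd := rfl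

theorem fst_add (x y : ModuleExtension M A) : (x + y).fst = x.fst + y.fst := rfl

theorem snd_add (x y : ModuleExtension M A) : (x + y).snd = x.snd + y.snd := rfl

theorem fst_zero : (0 : ModuleExtension M A).fst = 0 := rfl

theorem snd_zero : (0 : ModuleExtension M A).snd = 0 := rfl

theorem fst_smul (c : ℂ) (x : ModuleExtension M A) : (c • x).fst = c • x.fst := rfl

theorem snd_smul (c : ℂ) (x : ModuleExtension M A) : (c • x).snd = c • x.snd := rfl

instance : NonUnitalNormedRing (ModuleExtension M A) where
  __ := (inferInstance : NormedAddCommGroup (ModuleExtension M A))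
  mul := (· * ·)
  left_distrib x y z := by
    apply ext
    · simp only [fst_mul, fst_add, snd_add, lact, ract, map_add, add_apply]
      abel
    · simp only [snd_mul, snd_add, mul_add]
  right_distrib x y z := by
    apply ext
    · simp only [fst_mul, fst_add, snd_add, lact, ract, map_add, add_apply]
      abel
    · simp only [snd_mul, snd_add, add_mul]
  zero_mul x := by
    apply ext
    · simp [fst_mul, fst_zero, snd_zero, lact, ract]
    · simp [snd_mul, snd_zero]
  mul_zero x := by
    apply ext
    · simp [fst_mul, fst_zero, snd_zero, lact, ract]
    · simp [snd_mul, snd_zero]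
  mul_assoc x y z := by
    apply ext
    · simp only [fst_mul, snd_mul, lact, ract, map_add, BanachBimodule.left_mul,
        BanachBimodule.right_mul, BanachBimodule.left_right]
      abel
    · simp only [snd_mul, mul_assoc]
  norm_mul_le x y := by
    rw [norm_def, norm_def, norm_def, fst_mul, snd_mul]
    have h₁ : ‖ract x.fst y.snd‖ ≤ ‖y.snd‖ * ‖x.fst‖ := BanachBimodule.norm_right_le _ _
    have h₂ : ‖lact x.snd y.fst‖ ≤ ‖x.snd‖ * ‖y.fst‖ := BanachBimodule.norm_left_le _ _
    have h₃ := norm_add_le (ract x.fst y.snd) (lact x.snd y.fst)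
    have h₄ := norm_mul_le x.snd y.snd
    have h₅ : 0 ≤ ‖x.fst‖ * ‖y.fst‖ := by positivity
    linarith

instance [IsScalarTower ℂ A A] : IsScalarTower ℂ (ModuleExtension M A) (ModuleExtension M A) :=
  ⟨fun c x y => by
    apply ext
    · simp [fst_mul, fst_smul, snd_smul, lact, ract]
    · simp [snd_mul, snd_smul, smul_mul_assoc]⟩

instance [SMulCommClass ℂ A A] : SMulCommClass ℂ (ModuleExtension M A) (ModuleExtension M A) :=
  ⟨fun c x y => by
    apply ext
    · simp [fst_mul, fst_smul, snd_smul, lact, ract]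
    · simp [snd_mul, snd_smul, mul_smul_comm]⟩

end ModuleExtension

end

noncomputable section

/-! ### Arens products and second adjoints. -/

section ArensMaps

variable {A B : Type u} [NonUnitalNormedRing A] [NormedSpace ℂ A] [IsScalarTower ℂ A A]
  [SMulCommClass ℂ A A] [NonUnitalNormedRing B] [NormedSpace ℂ B] [IsScalarTower ℂ B B]
  [SMulCommClass ℂ B B]

/-! Write `B` for `M ⊕₁ A`. Reflexivity of `M` gives `B** = M + A**`. The two Arens products agree
whenever one factor lies in the canonical image of `B`, and on the copy of `A**` they agree because
second adjoints of homomorphisms respect both products (`Bidual.map_firstArens`,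
`Bidual.map_secondArens`). By bilinearity `B` is Arens regular.

For amenability, the main obstruction is the projection `B → M`. Its second adjoint `B** → M**` is a
weak*-continuous derivation, where `M**` is the dual of the `A**`-bimodule `M*` (`bidualBimodule`),
viewed as a `B**`-bimodule through `B** → A**`. An inner map for this structure kills every `(m,
0)`, since the actions only see the `A**` component, whereas the derivation sends `(m, 0)` to `m`.
So Connes amenability forces `M = 0`.

The remaining implications are instances of one principle (`IsConnesAmenable.of_surjective`): Connes
amenability passes along contractive weak*-continuous surjective homomorphisms, here `B** → A**`,
and `A** → B**` when `M = 0`. -/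

theorem firstArens_apply (Φ Ψ : StrongDual ℂ (StrongDual ℂ A)) (f : StrongDual ℂ A) :
    firstArens A Φ Ψ f = Φ (Ψ.comp (bilinAdjoint (ContinuousLinearMap.mul ℂ A) f)) := rfl

theorem secondArens_apply (Φ Ψ : StrongDual ℂ (StrongDual ℂ A)) (f : StrongDual ℂ A) :
    secondArens A Φ Ψ f = Ψ (Φ.comp (bilinAdjoint (ContinuousLinearMap.mul ℂ A).flip f)) := rfl

/-- Both sides send `f` to `Ψ` evaluated at `b ↦ f (a * b)`: with a point evaluation as one factor,
the order of application is immaterial. -/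
theorem firstArens_eq_secondArens_of_left (a : A) (Ψ : StrongDual ℂ (StrongDual ℂ A)) :
    firstArens A (NormedSpace.inclusionInDoubleDual ℂ A a) Ψ =
      secondArens A (NormedSpace.inclusionInDoubleDual ℂ A a) Ψ := by
  refine ContinuousLinearMap.ext fun f => ?_
  rw [firstArens_apply, secondArens_apply, NormedSpace.dual_def, ContinuousLinearMap.comp_apply]
  congr 1

theorem firstArens_eq_secondArens_of_right (Φ : StrongDual ℂ (StrongDual ℂ A)) (a : A) :
    firstArens A Φ (NormedSpace.inclusionInDoubleDual ℂ A a) =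
      secondArens A Φ (NormedSpace.inclusionInDoubleDual ℂ A a) := by
  refine ContinuousLinearMap.ext fun f => ?_
  rw [firstArens_apply, secondArens_apply, NormedSpace.dual_def, ContinuousLinearMap.comp_apply]
  congr 1

/-- An element of `A**`, as a functional on `A*`. -/
@[reducible] def Bidual.toDual (Φ : Bidual A) : StrongDual ℂ (StrongDual ℂ A) := Φ

/-- The second adjoint `A** → B**` of a bounded linear map `A → B`. -/
def Bidual.map (π : A →L[ℂ] B) : Bidual A →L[ℂ] Bidual B :=
  ContinuousLinearMap.precomp ℂ (ContinuousLinearMap.precomp ℂ π)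

theorem Bidual.map_firstArens (π : A →L[ℂ] B) (hπ : ∀ a b, π (a * b) = π a * π b)
    (Φ Ψ : StrongDual ℂ (StrongDual ℂ A)) :
    Bidual.map π (firstArens A Φ Ψ) = firstArens B (Bidual.map π Φ) (Bidual.map π Ψ) := by
  refine ContinuousLinearMap.ext fun g => ?_
  change Φ _ = Φ _
  congr 1
  refine ContinuousLinearMap.ext fun a => ?_
  change Ψ _ = Ψ _
  congr 1
  refine ContinuousLinearMap.ext fun b => ?_
  exact congrArg g (hπ a b)

theorem Bidual.map_secondArens (π : A →L[ℂ] B) (hπ : ∀ a b, π (a * b) = π a * π b)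
    (Φ Ψ : StrongDual ℂ (StrongDual ℂ A)) :
    Bidual.map π (secondArens A Φ Ψ) = secondArens B (Bidual.map π Φ) (Bidual.map π Ψ) := by
  refine ContinuousLinearMap.ext fun g => ?_
  change Ψ _ = Ψ _
  congr 1
  refine ContinuousLinearMap.ext fun b => ?_
  change Φ _ = Φ _
  congr 1
  refine ContinuousLinearMap.ext fun a => ?_
  exact congrArg g (hπ a b)

theorem Bidual.map_mul (π : A →L[ℂ] B) (hπ : ∀ a b, π (a * b) = π a * π b)
    (Φ Ψ : Bidual A) : Bidual.map π (Φ * Ψ) = Bidual.map π Φ * Bidual.map π Ψ :=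
  Bidual.map_firstArens π hπ Φ Ψ

theorem Bidual.norm_map_le (π : A →L[ℂ] B) (hπ : ∀ a, ‖π a‖ ≤ ‖a‖) (Φ : Bidual A) :
    ‖Bidual.map π Φ‖ ≤ ‖Φ‖ := by
  refine ContinuousLinearMap.opNorm_le_bound _ (norm_nonneg Φ) fun g => ?_
  refine (Φ.toDual.le_opNorm (g.comp π)).trans ?_
  refine mul_le_mul_of_nonneg_left ?_ (norm_nonneg Φ)
  refine ContinuousLinearMap.opNorm_le_bound _ (norm_nonneg g) fun a => ?_
  exact (g.le_opNorm _).trans (mul_le_mul_of_nonneg_left (hπ a) (norm_nonneg g))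

/-- The preimage comes from functoriality, so the section `σ` need only be linear and bounded; it
need not be multiplicative. -/
theorem Bidual.map_surjective (π : A →L[ℂ] B) (σ : B →L[ℂ] A) (h : ∀ b, π (σ b) = b) :
    Function.Surjective (Bidual.map π) := fun Φ => by
  refine ⟨Bidual.map σ Φ, ContinuousLinearMap.ext fun g => ?_⟩
  change Φ.toDual ((g.comp π).comp σ) = Φ.toDual g
  congr 1
  exact ContinuousLinearMap.ext fun b => congrArg g (h b)

end ArensMaps

/-! ### Weak* continuity and transfer of Connes amenability. -/

section WeakStar

variable {𝔄 𝔅 : Type u} [NonUnitalNormedRing 𝔄] [NormedSpace ℂ 𝔄]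
  [NonUnitalNormedRing 𝔅] [NormedSpace ℂ 𝔅]

theorem continuous_weakStarTopology_apply (P : Submodule ℂ (StrongDual ℂ 𝔄)) {f : StrongDual ℂ 𝔄}
    (hf : f ∈ P) : Continuous[weakStarTopology P, inferInstance] (fun a : 𝔄 => f a) := by
  let _ := weakStarTopology P
  exact (continuous_apply (A := fun _ : P => ℂ) (⟨f, hf⟩ : P)).comp
    (continuous_induced_dom (f := fun (a : 𝔄) (g : P) => g.1 a))

theorem isWeakStarContinuous_of_forall_mem (P : Submodule ℂ (StrongDual ℂ 𝔄)) {E : Type u}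
    [NormedAddCommGroup E] [NormedSpace ℂ E] (T : 𝔄 → StrongDual ℂ E)
    (h : ∀ x : E, ∃ f ∈ P, ∀ a, T a x = f a) : IsWeakStarContinuous P T := by
  let _ := weakStarTopology P
  refine WeakBilin.continuous_of_continuous_eval _ fun x => ?_
  obtain ⟨f, hf, hT⟩ := h x
  exact (continuous_weakStarTopology_apply P hf).congr fun a => (hT a).symm

theorem continuous_weakStarTopology_of_comp_mem {P : Submodule ℂ (StrongDual ℂ 𝔄)}
    {Q : Submodule ℂ (StrongDual ℂ 𝔅)} (T : 𝔄 →L[ℂ] 𝔅) (hT : ∀ g ∈ Q, g.comp T ∈ P) :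
    Continuous[weakStarTopology P, weakStarTopology Q] T := by
  let _ := weakStarTopology P
  refine continuous_induced_rng.2 (continuous_pi fun g => ?_)
  exact continuous_weakStarTopology_apply P (hT g g.2)

theorem IsWeakStarContinuous.comp {P : Submodule ℂ (StrongDual ℂ 𝔄)}
    {Q : Submodule ℂ (StrongDual ℂ 𝔅)} {E : Type u} [NormedAddCommGroup E] [NormedSpace ℂ E]
    {S : 𝔅 → StrongDual ℂ E} (hS : IsWeakStarContinuous Q S) (T : 𝔄 →L[ℂ] 𝔅)
    (hT : ∀ g ∈ Q, g.comp T ∈ P) : IsWeakStarContinuous P (fun a => S (T a)) :=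
  @Continuous.comp _ _ _ (weakStarTopology P) (weakStarTopology Q) _ _ _ hS
    (continuous_weakStarTopology_of_comp_mem T hT)

/-- A bimodule over `𝔅`, regarded as a bimodule over `𝔄` along a contractive homomorphism
`𝔄 → 𝔅`. -/
@[reducible] def BanachBimodule.pullback (T : 𝔄 →L[ℂ] 𝔅) (hmul : ∀ a b, T (a * b) = T a * T b)
    (hnorm : ∀ a, ‖T a‖ ≤ ‖a‖) (E : Type*) [NormedAddCommGroup E] [NormedSpace ℂ E]
    [BanachBimodule 𝔅 E] : BanachBimodule 𝔄 E where
  left := (BanachBimodule.left (A := 𝔅) (E := E)).comp T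
  right := (BanachBimodule.right (A := 𝔅) (E := E)).comp T
  left_mul a b x := by simp [hmul, BanachBimodule.left_mul]
  right_mul a b x := by simp [hmul, BanachBimodule.right_mul]
  left_right a b x := by simp [BanachBimodule.left_right]
  norm_left_le a x := (BanachBimodule.norm_left_le (T a) x).trans
    (mul_le_mul_of_nonneg_right (hnorm a) (norm_nonneg x))
  norm_right_le a x := (BanachBimodule.norm_right_le (T a) x).trans
    (mul_le_mul_of_nonneg_right (hnorm a) (norm_nonneg x))

theorem IsNormalDual.pullback {P : Submodule ℂ (StrongDual ℂ 𝔄)}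
    {Q : Submodule ℂ (StrongDual ℂ 𝔅)} (T : 𝔄 →L[ℂ] 𝔅) (hmul : ∀ a b, T (a * b) = T a * T b)
    (hnorm : ∀ a, ‖T a‖ ≤ ‖a‖) (hT : ∀ g ∈ Q, g.comp T ∈ P) (E : Type u)
    [NormedAddCommGroup E] [NormedSpace ℂ E] [BanachBimodule 𝔅 E] (hE : IsNormalDual Q E) :
    letI := BanachBimodule.pullback T hmul hnorm E
    IsNormalDual P E :=
  fun φ => ⟨(hE φ).1.comp T hT, (hE φ).2.comp T hT⟩

variable [IsScalarTower ℂ 𝔄 𝔄] [SMulCommClass ℂ 𝔄 𝔄] [IsScalarTower ℂ 𝔅 𝔅]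
  [SMulCommClass ℂ 𝔅 𝔅]

/-- A derivation over `𝔅` pulls back along `T` to one over `𝔄`; an element implementing the pullback
implements the original, since every element of `𝔅` is some `T a`. -/
theorem IsConnesAmenable.of_surjective {P : Submodule ℂ (StrongDual ℂ 𝔄)}
    {Q : Submodule ℂ (StrongDual ℂ 𝔅)} (h : IsConnesAmenable P) (hQ : IsPredual Q)
    (T : 𝔄 →L[ℂ] 𝔅) (hmul : ∀ a b, T (a * b) = T a * T b)
    (hnorm : ∀ a, ‖T a‖ ≤ ‖a‖) (hT : ∀ g ∈ Q, g.comp T ∈ P) (hsurj : Function.Surjective T) :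
    IsConnesAmenable Q := by
  refine ⟨hQ, fun E _ _ _ _ hE D hD hDc => ?_⟩
  obtain ⟨x, hx⟩ := @And.right _ _ h E _ _ _ (BanachBimodule.pullback T hmul hnorm E)
    (hE.pullback T hmul hnorm hT) (D.comp T.toLinearMap)
    (fun a b => (congrArg D (hmul a b)).trans (hD (T a) (T b))) (hDc.comp T hT)
  refine ⟨x, fun b => ?_⟩
  obtain ⟨a, rfl⟩ := hsurj b
  exact hx a

end WeakStar

/-! ### The bidual as a dual Banach algebra. -/

section BidualPredual

variable {A B : Type u} [NonUnitalNormedRing A] [NormedSpace ℂ A] [IsScalarTower ℂ A A]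
  [SMulCommClass ℂ A A] [NonUnitalNormedRing B] [NormedSpace ℂ B] [IsScalarTower ℂ B B]
  [SMulCommClass ℂ B B]

theorem IsArensRegular.isPredual (hA : IsArensRegular A) : IsPredual (Bidual.predual A) where
  isClosed := by
    have h : Isometry (NormedSpace.inclusionInDoubleDual ℂ (StrongDual ℂ A)) :=
      (NormedSpace.inclusionInDoubleDualLi ℂ (E := StrongDual ℂ A)).isometry
    have := h.isClosedEmbedding.isClosed_range
    exact this
  mul_left_mem := by
    rintro _ ⟨g, rfl⟩ Ψ
    refine ⟨ContinuousLinearMap.comp Ψ.toDual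
      (bilinAdjoint (ContinuousLinearMap.mul ℂ A).flip g), ContinuousLinearMap.ext fun Φ => ?_⟩
    -- Regularity enters here: `Φ ↦ ⟨Ψ □ Φ, g⟩` is given by an element of `A*` once `□` is replaced
    -- by `◇`. The other side is automatic for `□`.
    exact (DFunLike.congr_fun (hA Ψ Φ) g).symm
  mul_right_mem := by
    rintro _ ⟨g, rfl⟩ Ψ
    exact ⟨ContinuousLinearMap.comp Ψ.toDual
      (bilinAdjoint (ContinuousLinearMap.mul ℂ A) g), rfl⟩
  bijective := by
    constructor
    · intro Φ Ψ h
      refine ContinuousLinearMap.ext fun g => ?_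
      exact DFunLike.congr_fun h
        ⟨NormedSpace.inclusionInDoubleDual ℂ (StrongDual ℂ A) g, g, rfl⟩
    · intro F
      let J : StrongDual ℂ A →L[ℂ] Bidual.predual A :=
        (NormedSpace.inclusionInDoubleDual ℂ (StrongDual ℂ A)).codRestrict (Bidual.predual A)
          fun g => ⟨g, rfl⟩
      refine ⟨F.comp J, ContinuousLinearMap.ext ?_⟩
      rintro ⟨_, g, rfl⟩
      rfl
  norm_eval Φ := by
    refine le_antisymm ?_ ?_
    · refine ContinuousLinearMap.opNorm_le_bound _ (norm_nonneg Φ) fun f => ?_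
      rw [mul_comm]
      exact (f : StrongDual ℂ (Bidual A)).le_opNorm Φ
    · refine ContinuousLinearMap.opNorm_le_bound _ (norm_nonneg _) fun g => ?_
      refine ((predualEval (Bidual.predual A) Φ).le_opNorm
        ⟨NormedSpace.inclusionInDoubleDual ℂ (StrongDual ℂ A) g, g, rfl⟩).trans ?_
      refine mul_le_mul_of_nonneg_left ?_ (norm_nonneg _)
      exact NormedSpace.double_dual_bound ℂ (StrongDual ℂ A) g

theorem Bidual.comp_map_mem_predual (π : A →L[ℂ] B) :
    ∀ g ∈ Bidual.predual B, g.comp (Bidual.map π) ∈ Bidual.predual A := by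
  rintro _ ⟨g, rfl⟩
  exact ⟨g.comp π, rfl⟩

/-- Connes amenability of the bidual passes to contractive split quotients. -/
theorem IsConnesAmenable.bidual_of_rightInverse (h : IsConnesAmenable (Bidual.predual A))
    (hB : IsArensRegular B) (π : A →L[ℂ] B) (hmul : ∀ a b, π (a * b) = π a * π b)
    (hnorm : ∀ a, ‖π a‖ ≤ ‖a‖) (σ : B →L[ℂ] A) (hσ : ∀ b, π (σ b) = b) :
    IsConnesAmenable (Bidual.predual B) :=
  h.of_surjective hB.isPredual (Bidual.map π) (Bidual.map_mul π hmul) (Bidual.norm_map_le π hnorm)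
    (Bidual.comp_map_mem_predual π) (Bidual.map_surjective π σ hσ)

end BidualPredual

/-! ### The `A**`-bimodule structure on `M*`. -/

section ReflexiveModule

variable {A M : Type u} [NonUnitalNormedRing A] [NormedSpace ℂ A] [IsScalarTower ℂ A A]
  [SMulCommClass ℂ A A] [NormedAddCommGroup M] [NormedSpace ℂ M] [BanachBimodule A M]

/-- The dual of a reflexive bimodule over an Arens regular algebra `A` is a bimodule over `A**`,
with `⟨Φ · f, m⟩ = ⟨Φ, a ↦ ⟨f, m · a⟩⟩` and `⟨f · Φ, m⟩ = ⟨Φ, a ↦ ⟨f, a · m⟩⟩`. -/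
@[reducible] def bidualBimodule (hA : IsArensRegular A) (hM : IsReflexiveSpace M) :
    BanachBimodule (Bidual A) (StrongDual ℂ M) where
  left := bilinAdjoint (bilinAdjoint (BanachBimodule.right (A := A) (E := M)).flip)
  right := bilinAdjoint (bilinAdjoint (BanachBimodule.left (A := A) (E := M)).flip)
  left_mul Φ Ψ f := by
    refine ContinuousLinearMap.ext fun m => ?_
    change Φ.toDual _ = Φ.toDual _
    congr 1
    refine ContinuousLinearMap.ext fun a => ?_
    change Ψ.toDual _ = Ψ.toDual _
    congr 1
    refine ContinuousLinearMap.ext fun b => ?_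
    exact congrArg f (BanachBimodule.right_mul a b m)
  right_mul Φ Ψ f := by
    -- Unfolding `(f · Φ) · Ψ` applies `Ψ` outermost, which is the order of the second Arens
    -- product.
    rw [Bidual.mul_def, hA Φ Ψ]
    refine ContinuousLinearMap.ext fun m => ?_
    change Ψ.toDual _ = Ψ.toDual _
    congr 1
    refine ContinuousLinearMap.ext fun b => ?_
    change Φ.toDual _ = Φ.toDual _
    congr 1
    refine ContinuousLinearMap.ext fun a => ?_
    exact congrArg f (BanachBimodule.left_mul a b m)
  left_right Φ Ψ f := by
    refine ContinuousLinearMap.ext fun m => ?_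
    -- By reflexivity `m · Φ` is an actual element `n` of `M`. This allows `Φ` and `Ψ` to be
    -- interchanged.
    obtain ⟨n, hn⟩ := hM (ContinuousLinearMap.comp Φ.toDual
      ((bilinAdjoint (BanachBimodule.right (A := A) (E := M)).flip).flip m))
    have key (g : StrongDual ℂ M) : g n = Φ.toDual
        (bilinAdjoint (BanachBimodule.right (A := A) (E := M)).flip g m) :=
      DFunLike.congr_fun hn g
    trans Ψ.toDual
      (bilinAdjoint (BanachBimodule.left (A := A) (E := M)).flip f n)
    · change Ψ.toDual _ = Ψ.toDual _
      congr 1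
      refine ContinuousLinearMap.ext fun b => ?_
      refine Eq.trans ?_ (key (f.comp (BanachBimodule.left b))).symm
      change Φ.toDual _ = Φ.toDual _
      congr 1
      refine ContinuousLinearMap.ext fun a => ?_
      exact congrArg f (BanachBimodule.left_right b a m)
    · exact key (bilinAdjoint (bilinAdjoint (BanachBimodule.left (A := A) (E := M)).flip) Ψ f)
  norm_left_le := norm_bilinAdjoint_apply_le _ <| norm_bilinAdjoint_apply_le _ fun m a =>
    (BanachBimodule.norm_right_le a m).trans_eq (mul_comm _ _)
  norm_right_le := norm_bilinAdjoint_apply_le _ <| norm_bilinAdjoint_apply_le _ fun m a =>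
    (BanachBimodule.norm_left_le a m).trans_eq (mul_comm _ _)

/-- Every `φ ∈ M**` is evaluation at some `m`, so `⟨Φ · φ, f⟩ = ⟨Φ, a ↦ f (a · m)⟩` is evaluation of
`Φ` at an element of `A*`; likewise on the other side. -/
theorem isNormalDual_bidualBimodule (hA : IsArensRegular A) (hM : IsReflexiveSpace M) :
    letI := bidualBimodule hA hM
    IsNormalDual (Bidual.predual A) (StrongDual ℂ M) := by
  intro φ
  obtain ⟨m, rfl⟩ := hM φ
  exact ⟨isWeakStarContinuous_of_forall_mem _ _ fun f => ⟨_,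
      ⟨bilinAdjoint (BanachBimodule.left (A := A) (E := M)).flip f m, rfl⟩, fun _ => rfl⟩,
    isWeakStarContinuous_of_forall_mem _ _ fun f => ⟨_,
      ⟨bilinAdjoint (BanachBimodule.right (A := A) (E := M)).flip f m, rfl⟩, fun _ => rfl⟩⟩

end ReflexiveModule

/-! ### The module extension, its bidual and the obstructing derivation. -/

namespace ModuleExtension

variable {M A : Type u} [NonUnitalNormedRing A] [NormedSpace ℂ A] [NormedAddCommGroup M]
  [NormedSpace ℂ M] [BanachBimodule A M]

theorem norm_fst_le (x : ModuleExtension M A) : ‖x.fst‖ ≤ ‖x‖ := by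
  rw [norm_def]; exact le_add_of_nonneg_right (norm_nonneg _)

theorem norm_snd_le (x : ModuleExtension M A) : ‖x.snd‖ ≤ ‖x‖ := by
  rw [norm_def]; exact le_add_of_nonneg_left (norm_nonneg _)

theorem norm_mk (m : M) (a : A) : ‖(mk m a : ModuleExtension M A)‖ = ‖m‖ + ‖a‖ := norm_def _

variable (M A)

/-- The projection onto `M`. -/
def fstL : ModuleExtension M A →L[ℂ] M :=
  LinearMap.mkContinuous ⟨⟨fst, fst_add⟩, fst_smul⟩ 1 fun x => by
    rw [one_mul]; exact norm_fst_le x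

/-- The projection onto `A`. -/
def sndL : ModuleExtension M A →L[ℂ] A :=
  LinearMap.mkContinuous ⟨⟨snd, snd_add⟩, snd_smul⟩ 1 fun x => by
    rw [one_mul]; exact norm_snd_le x

/-- The inclusion `m ↦ (m, 0)`. -/
def inlL : M →L[ℂ] ModuleExtension M A :=
  LinearMap.mkContinuous ⟨⟨fun m => mk m 0, fun _ _ => ext rfl (add_zero (0 : A)).symm⟩,
    fun c _ => ext rfl (smul_zero c : c • (0 : A) = 0).symm⟩ 1 fun m => by
      change ‖(mk m 0 : ModuleExtension M A)‖ ≤ _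
      rw [norm_mk, norm_zero, add_zero, one_mul]

/-- The inclusion `a ↦ (0, a)`. -/
def inrL : A →L[ℂ] ModuleExtension M A :=
  LinearMap.mkContinuous ⟨⟨fun a => mk 0 a, fun _ _ => ext (add_zero (0 : M)).symm rfl⟩,
    fun c _ => ext (smul_zero c : c • (0 : M) = 0).symm rfl⟩ 1 fun a => by
      change ‖(mk 0 a : ModuleExtension M A)‖ ≤ _
      rw [norm_mk, norm_zero, zero_add, one_mul]

variable {M A}

theorem norm_inrL (a : A) : ‖inrL M A a‖ = ‖a‖ := by
  change ‖(mk 0 a : ModuleExtension M A)‖ = _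
  rw [norm_mk, norm_zero, zero_add]

theorem inlL_add_inrL (x : ModuleExtension M A) : inlL M A x.fst + inrL M A x.snd = x :=
  ext (add_zero x.fst) (zero_add x.snd)

theorem sndL_mul (x y : ModuleExtension M A) : sndL M A (x * y) = sndL M A x * sndL M A y := rfl

theorem inrL_mul (a b : A) : inrL M A (a * b) = inrL M A a * inrL M A b := by
  refine ext ?_ rfl
  change (0 : M) = BanachBimodule.right b (0 : M) + BanachBimodule.left a (0 : M)
  simp

variable [IsScalarTower ℂ A A] [SMulCommClass ℂ A A]

/-- If `M` is reflexive, every element of `(M ⊕₁ A)**` is the sum of an element of `M` and the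
image of an element of `A**`. -/
theorem exists_bidual_eq (hM : IsReflexiveSpace M)
    (Φ : StrongDual ℂ (StrongDual ℂ (ModuleExtension M A))) :
    ∃ (m : M) (Θ : StrongDual ℂ (StrongDual ℂ A)),
      Φ = NormedSpace.inclusionInDoubleDual ℂ (ModuleExtension M A) (inlL M A m) +
        (Bidual.map (inrL M A) Θ).toDual := by
  obtain ⟨m, hm⟩ := hM (Φ.comp (ContinuousLinearMap.precomp ℂ (fstL M A)))
  refine ⟨m, Bidual.map (sndL M A) Φ, ContinuousLinearMap.ext fun g => ?_⟩
  have h₁ : g (inlL M A m) = Φ ((g.comp (inlL M A)).comp (fstL M A)) :=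
    DFunLike.congr_fun hm (g.comp (inlL M A))
  have h₂ : g = (g.comp (inlL M A)).comp (fstL M A) + (g.comp (inrL M A)).comp (sndL M A) := by
    refine ContinuousLinearMap.ext fun x => ?_
    exact (congrArg g (inlL_add_inrL x)).symm.trans (map_add g _ _)
  change Φ g = g (inlL M A m) + Φ ((g.comp (inrL M A)).comp (sndL M A))
  rw [h₁, ← map_add, ← h₂]

theorem isArensRegular (hA : IsArensRegular A) (hM : IsReflexiveSpace M) :
    IsArensRegular (ModuleExtension M A) := by
  intro Φ Ψ
  obtain ⟨m, Θ, rfl⟩ := exists_bidual_eq hM Φ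
  obtain ⟨n, Ξ, rfl⟩ := exists_bidual_eq hM Ψ
  have h : firstArens (ModuleExtension M A) (Bidual.map (inrL M A) Θ) (Bidual.map (inrL M A) Ξ) =
      secondArens (ModuleExtension M A) (Bidual.map (inrL M A) Θ) (Bidual.map (inrL M A) Ξ) := by
    rw [← Bidual.map_firstArens _ inrL_mul, ← Bidual.map_secondArens _ inrL_mul, hA]
  simp only [map_add, add_apply, firstArens_eq_secondArens_of_left,
    firstArens_eq_secondArens_of_right, h]

/-- The second adjoint of the projection onto `M`, a derivation of `(M ⊕₁ A)**`. -/
def bidualFst : Bidual (ModuleExtension M A) →ₗ[ℂ] StrongDual ℂ (StrongDual ℂ M) :=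
  (ContinuousLinearMap.precomp ℂ (ContinuousLinearMap.precomp ℂ (fstL M A)) :
    StrongDual ℂ (StrongDual ℂ (ModuleExtension M A)) →L[ℂ] _).toLinearMap

theorem subsingleton_of_isConnesAmenable (hA : IsArensRegular A) (hM : IsReflexiveSpace M)
    (h : IsConnesAmenable (Bidual.predual (ModuleExtension M A))) : Subsingleton M := by
  let _ := bidualBimodule hA hM
  have hnormal := isNormalDual_bidualBimodule hA hM
  let _ := BanachBimodule.pullback (Bidual.map (sndL M A)) (Bidual.map_mul _ sndL_mul)
    (Bidual.norm_map_le _ norm_snd_le) (StrongDual ℂ M)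
  have hder : IsDerivationMap (bidualFst (M := M) (A := A)) := by
    intro Φ Ψ
    -- Representing the `M**` component of `Ψ` by `n ∈ M` turns `⟨Φ · n, f⟩` into `Φ` applied to `x
    -- ↦ f (x.snd · n)`. Both sides then have `Φ` outermost, and after the same step for `Ψ` the
    -- identity is the formula for the product of the extension.
    obtain ⟨n, hn⟩ := hM (bidualFst Ψ)
    have key (g : StrongDual ℂ M) : g n =
        Ψ.toDual (g.comp (fstL M A)) :=
      DFunLike.congr_fun hn g
    refine ContinuousLinearMap.ext fun f => ?_
    rw [← hn]
    change Φ.toDual _ =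
      Φ.toDual _ +
      Φ.toDual
        ((bilinAdjoint (BanachBimodule.left (A := A) (E := M)).flip f n).comp (sndL M A))
    rw [← map_add]
    congr 1
    refine ContinuousLinearMap.ext fun x => ?_
    change _ = Ψ.toDual
      ((bilinAdjoint (BanachBimodule.right (A := A) (E := M)).flip f x.fst).comp (sndL M A)) +
      (f.comp (BanachBimodule.left x.snd)) n
    rw [key, ← map_add]
    change Ψ.toDual _ = _
    congr 1
    refine ContinuousLinearMap.ext fun y => ?_
    exact map_add f (ract x.fst y.snd) (lact x.snd y.fst)
  obtain ⟨φ, hφ⟩ := h.2 (StrongDual ℂ M)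
    (hnormal.pullback (Bidual.map (sndL M A)) (Bidual.map_mul _ sndL_mul)
      (Bidual.norm_map_le _ norm_snd_le) (Bidual.comp_map_mem_predual _))
    bidualFst hder
    (isWeakStarContinuous_of_forall_mem _ _ fun f => ⟨_, ⟨f.comp (fstL M A), rfl⟩, fun _ => rfl⟩)
  refine subsingleton_of_forall_eq 0 fun m => ?_
  -- Test innerness on `(m, 0)`, which has zero `A**` component and hence acts trivially.
  let Φ : Bidual (ModuleExtension M A) :=
    NormedSpace.inclusionInDoubleDual ℂ (ModuleExtension M A) (inlL M A m)
  have hΦ : Bidual.map (sndL M A) Φ = 0 :=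
    ContinuousLinearMap.ext fun g => map_zero g
  have hm : bidualFst Φ = 0 := by
    rw [hφ Φ]
    change BanachBimodule.left (Bidual.map (sndL M A) Φ) φ -
      BanachBimodule.right (Bidual.map (sndL M A) Φ) φ = 0
    simp [hΦ]
  refine SeparatingDual.eq_zero_of_forall_dual_eq_zero (R := ℂ) fun g => ?_
  exact DFunLike.congr_fun hm g

end ModuleExtension

end

theorem theorem2p1 (A : Type u) [NonUnitalNormedRing A] [NormedSpace ℂ A] [IsScalarTower ℂ A A]
    [SMulCommClass ℂ A A] [CompleteSpace A] (hA : IsArensRegular A)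
    (M : Type u) [NormedAddCommGroup M] [NormedSpace ℂ M] [CompleteSpace M] [BanachBimodule A M]
    (hM : IsReflexiveSpace M) :
    IsArensRegular (ModuleExtension M A) ∧
    (IsConnesAmenable (Bidual.predual (ModuleExtension M A)) ↔
      Subsingleton M ∧ IsConnesAmenable (Bidual.predual A)) := by
  have hB := ModuleExtension.isArensRegular hA hM
  refine ⟨hB, fun h => ⟨ModuleExtension.subsingleton_of_isConnesAmenable hA hM h, ?_⟩, ?_⟩
  · exact h.bidual_of_rightInverse hA (ModuleExtension.sndL M A) ModuleExtension.sndL_mul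
      ModuleExtension.norm_snd_le (ModuleExtension.inrL M A) fun _ => rfl
  · rintro ⟨_, h⟩
    -- With `M = 0` the roles reverse: the inclusion of `A` is the quotient map and the projection
    -- onto `A` is its right inverse.
    exact h.bidual_of_rightInverse hB (ModuleExtension.inrL M A) ModuleExtension.inrL_mul
      (fun a => (ModuleExtension.norm_inrL a).le) (ModuleExtension.sndL M A)
      fun x => ModuleExtension.ext (Subsingleton.elim _ _) rfl
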